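/- Let $t$ be an indeterminate and let $\Lambda_F$ be the ring of symmetric functions over $F=\mathbb{Q}(t)$, with the Hall--Littlewood bilinear form $\langle p_\lambda,p_\mu\rangle=\delta_{\lambda\mu}z_\lambda(t)$, $z_\lambda(t)=\prod_{i\ge1}i^{m_i(\lambda)}m_i(\lambda)!\,/\prod_{i}(1-t^{\lambda_i})$, where $p_\lambda$ are the power sums and $m_i(\lambda)$ is the multiplicity of the part $i$ in $\lambda$. Let $q_n=\sum_{\lambda\vdash n}z_\lambda(t)^{-1}p_\lambda$ for $n\ge 0$, $q_n=0$ for $n<0$, and $q_\mu=q_{\mu_1}q_{\mu_2}\cdots$. For a partition $\nu$ of length $m$ let $$Q_\nu(t)=\prod_{1\le i<j\le m}\frac{1-R_{ij}}{1-tR_{ij}}\;q_{\nu_1}\cdots q_{\nu_m}$$ be the Hall--Littlewood function, where the raising operator $R_{ij}$ replaces $q_{\alpha_1}\cdots q_{\alpha_m}$ by the product in which $\alpha_i,\alpha_j$ have become $\alpha_i+1,\alpha_j-1$. For partitions $\nu,\mu$ put $$B^{\nu}_{\mu}(t)=\langle Q_\nu(t),q_\mu(t)\rangle .$$ For an integer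 sequence $\alpha=(\alpha_1,\dots,\alpha_m)$ with $d=\alpha_{i+1}-\alpha_i>0$ and $0\le a\le\lfloor d/2\rfloor$ let $S_{i,a}\alpha$ be the sequence obtained from $\alpha$ by replacing $(\alpha_i,\alpha_{i+1})$ by $(\alpha_{i+1}-a,\alpha_i+a)$, with the coefficient $$C(S_{i,a})=\begin{cases}t,&a=0,\\ t^{a+1}-t^{a-1},&1\le a<\lfloor d/2\rfloor,\\ t^{a+\epsilon}-t^{a-1},&a=\lfloor d/2\rfloor\ge1,\end{cases}$$ where $\epsilon\in\{0,1\}$ is the parity of $d$. Fix a straightening order, that is, any rule which chooses for every integer sequence $\alpha$ of length $m$ that is not weakly decreasing one position $i$ with $\alpha_i<\alpha_{i+1}$. For a partition $\lambda$ the straightening coefficient is $$B(\lambda,\alpha)=\sum C(S_{i_1,a_1})\cdots C(S_{i_r,a_r}),$$ summed over all $r\ge0$ and all sequences of steps with $S_{i_1,a_1}\cdots S_{i_r,a_r}\alpha=\lambda$ (where $\lambda$ is padded with zeros to length $m$) in which the position of each step is the one that the rule chooses for the sequence to which the step is applied. Then for every $n\ge0$, all partitions $\mu,\nu\vdash n$,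 and every straightening order for sequences of length $l(\nu)$, $$B^{\nu}_{\mu}(t)=\sum_{\substack{\lambda\vdash n-\mu_1\\ \lambda\subset\nu}}\ \sum_{\tau\models\mu_1}(1-t)^{l(\tau)}\,B(\lambda,\nu-\tau)\,B^{\lambda}_{\mu^{[1]}}(t).$$ Here $\mu^{[1]}=(\mu_2,\mu_3,\dots)$ (and $\mu_1=0$, $\mu^{[1]}=\emptyset$ if $\mu=\emptyset$), $\lambda\subset\nu$ is containment of Young diagrams, $\tau=(\tau_1,\dots,\tau_{l(\nu)})$ runs over the sequences of $l(\nu)$ nonnegative integers with sum $\mu_1$, $l(\tau)$ is the number of nonzero entries of $\tau$, and $\nu-\tau$ is the entrywise difference. -/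

import Mathlib

namespace HallLittlewood

noncomputable section

/-! ### The ring of symmetric functions over `ℚ(t)` and the Hall-Littlewood form -/

/-- The field `F = ℚ(t)`. -/
abbrev F : Type := RatFunc ℚ

/-- The indeterminate `t`. -/
def t : F := RatFunc.X

/-- The ring of symmetric functions over `F`. It is the polynomial ring in the power sums
`p_1, p_2, …`; the variable of index `r` is the power sum `p_r`. -/
abbrev V : Type := MvPolynomial ℕ+ F

/-- The power sum `p_r` for `r ≥ 1` (the value at `0` is never used). -/
def powerSum (r : ℕ) : V := if h : 0 < r then MvPolynomial.X ⟨r, h⟩ else 0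

/-- `z_λ(t) = ∏_i i ^ m_i m_i! / ∏_i (1 - t ^ λ_i)` for the multiset of the parts of `λ`. -/
def zt (lam : Multiset ℕ) : F :=
  (∏ i ∈ lam.toFinset, ((i : F) ^ lam.count i * ((lam.count i).factorial : F))) /
    (lam.map fun i => 1 - t ^ i).prod

/-- The multiset of parts of the partition `λ` such that the monomial with exponents `s`
is `p_λ`. -/
def partsOfExponents (s : ℕ+ →₀ ℕ) : Multiset ℕ := (Finsupp.toMultiset s).map fun r => (r : ℕ)

/-- The Hall-Littlewood bilinear form on `V`: `⟨p_λ, p_μ⟩ = δ_{λ μ} z_λ(t)`. -/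
def form : LinearMap.BilinForm F V :=
  (MvPolynomial.basisMonomials ℕ+ F).constr F
    fun s => zt (partsOfExponents s) • MvPolynomial.lcoeff F s

/-- The one-row Hall-Littlewood function `q_n = ∑_{λ ⊢ n} z_λ(t)⁻¹ p_λ`. -/
def q (n : ℕ) : V :=
  ∑ lam : Nat.Partition n, (zt lam.parts)⁻¹ • (lam.parts.map powerSum).prod

/-- `q_k` for an integer index: `q_k = 0` if `k < 0`. -/
def qInt (k : ℤ) : V := if 0 ≤ k then q k.toNat else 0

/-- `q_μ = q_{μ_1} q_{μ_2} ⋯`. -/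
def qProd (mu : List ℕ) : V := (mu.map q).prod

/-! ### Hall-Littlewood functions by raising operators -/

/-- The coefficient of `R ^ k` in `(1 - R) / (1 - t R)`. -/
def raisingCoeff (k : ℕ) : F := if k = 0 then 1 else t ^ k - t ^ (k - 1)

/-- The pairs `i < j` of positions. -/
abbrev Pairs (m : ℕ) : Type := {p : Fin m × Fin m // p.1 < p.2}

/-- The integer sequence `∏_{i < j} R_{ij} ^ {k_{ij}} α`, where `R_{ij}` adds `1` to the `i`-th
entry and subtracts `1` from the `j`-th entry. -/
def raise {m : ℕ} (k : Pairs m → ℕ) (α : Fin m → ℤ) : Fin m → ℤ := fun i =>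
  α i + (∑ p : Pairs m, if p.1.1 = i then (k p : ℤ) else 0)
    - ∑ p : Pairs m, if p.1.2 = i then (k p : ℤ) else 0

/-- The summand of `∏_{i < j} (1 - R_{ij}) / (1 - t R_{ij}) q_α` belonging to the exponents
`k_{ij}` of the operators `R_{ij}`. -/
def raisingTerm {m : ℕ} (α : Fin m → ℤ) (k : Pairs m → ℕ) : V :=
  (∏ p, raisingCoeff (k p)) • ∏ i, qInt (raise k α i)

/-- `Q_α = ∏_{i < j} (1 - R_{ij}) / (1 - t R_{ij}) q_α`. By `raisingTerm_support_finite` only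
finitely many summands are nonzero. -/
def hallQ {m : ℕ} (α : Fin m → ℤ) : V := ∑ᶠ k : Pairs m → ℕ, raisingTerm α k

theorem raise_nonneg_bound {m : ℕ} (α : Fin m → ℤ) (k : Pairs m → ℕ)
    (h : ∀ i, 0 ≤ raise k α i) (p : Pairs m) : (k p : ℤ) ≤ ∑ i, |α i| := by
  have h1 : 0 ≤ ∑ i, if p.1.2 ≤ i then raise k α i else 0 :=
    Finset.sum_nonneg fun i _ => by split_ifs <;> simp [h i]
  have h2 : (∑ i, if p.1.2 ≤ i then raise k α i else 0)
      = (∑ i, if p.1.2 ≤ i then α i else 0)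
        + ∑ r : Pairs m, ((if p.1.2 ≤ r.1.1 then (k r : ℤ) else 0)
          - if p.1.2 ≤ r.1.2 then (k r : ℤ) else 0) := by
    have e1 : ∀ f : Pairs m → Fin m, (∑ i, if p.1.2 ≤ i then
        (∑ r : Pairs m, if f r = i then (k r : ℤ) else 0) else 0)
        = ∑ r : Pairs m, if p.1.2 ≤ f r then (k r : ℤ) else 0 := by
      intro f
      have : ∀ i, (if p.1.2 ≤ i then (∑ r : Pairs m, if f r = i then (k r : ℤ) else 0) else 0)
          = ∑ r : Pairs m, if f r = i then (if p.1.2 ≤ f r then (k r : ℤ) else 0) else 0 := by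
        intro i
        split_ifs with hi
        · refine Finset.sum_congr rfl fun r _ => ?_
          by_cases hr : f r = i
          · simp [hr, hi]
          · simp [hr]
        · symm
          refine Finset.sum_eq_zero fun r _ => ?_
          by_cases hr : f r = i
          · simp [hr, hi]
          · simp [hr]
      simp_rw [this]
      rw [Finset.sum_comm]
      simp
    rw [Finset.sum_sub_distrib, ← e1, ← e1, ← Finset.sum_sub_distrib, ← Finset.sum_add_distrib]
    refine Finset.sum_congr rfl fun i _ => ?_
    by_cases hi : p.1.2 ≤ i
    · simp only [hi, if_true, raise]; ring
    · simp [hi]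
  have h3 : (∑ i, if p.1.2 ≤ i then α i else 0) ≤ ∑ i, |α i| :=
    Finset.sum_le_sum fun i _ => by split_ifs <;> [exact le_abs_self _; exact abs_nonneg _]
  have h4 : (∑ r : Pairs m, ((if p.1.2 ≤ r.1.1 then (k r : ℤ) else 0)
          - if p.1.2 ≤ r.1.2 then (k r : ℤ) else 0)) ≤ - (k p : ℤ) := by
    have hp : -(k p : ℤ) = ∑ r : Pairs m, if r = p then -(k r : ℤ) else 0 := by simp
    rw [hp]
    refine Finset.sum_le_sum fun r _ => ?_
    by_cases hr : r = p
    · subst hr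
      simp [not_le.mpr r.2]
    · rw [if_neg hr]
      by_cases ha : p.1.2 ≤ r.1.1
      · simp [ha, ha.trans r.2.le]
      · rw [if_neg ha]; split_ifs <;> simp
  linarith

theorem raisingTerm_support_finite {m : ℕ} (α : Fin m → ℤ) :
    (Function.support (raisingTerm α)).Finite := by
  classical
  refine (Finset.finite_toSet
    (Fintype.piFinset fun _ : Pairs m => Finset.range ((∑ i, |α i|).toNat + 1))).subset ?_
  intro k hk
  have h : ∀ i, 0 ≤ raise k α i := by
    by_contra hc
    push Not at hc
    obtain ⟨i, hi⟩ := hc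
    refine hk ?_
    unfold raisingTerm
    rw [Finset.prod_eq_zero (Finset.mem_univ i), smul_zero]
    simp [qInt, hi]
  simp only [Finset.mem_coe, Fintype.mem_piFinset, Finset.mem_range]
  intro p
  have := raise_nonneg_bound α k h p
  omega

/-! ### Partitions and the pairing `B^ν_μ(t)` -/

/-- The parts of a partition in weakly decreasing order. -/
def rows {n : ℕ} (lam : Nat.Partition n) : List ℕ := lam.parts.sort (· ≥ ·)

/-- The set of the partitions `λ ⊢ k` with `λ ⊂ ν` (containment of Young diagrams). -/
def subPartitions (k : ℕ) (nu : List ℕ) : Finset (Nat.Partition k) :=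
  open Classical in
  Finset.univ.filter fun lam => ∀ i : ℕ, (rows lam).getD i 0 ≤ nu.getD i 0

/-- The Hall-Littlewood function `Q_λ(t)`, where `λ` is given by the list of its parts. -/
def hallLittlewoodQ (lam : List ℕ) : V := hallQ fun i : Fin lam.length => (lam.get i : ℤ)

/-- `B^ν_μ(t) = ⟨Q_ν(t), q_μ(t)⟩`. -/
def pairingB (nu mu : List ℕ) : F := form (hallLittlewoodQ nu) (qProd mu)

/-! ### Straightening -/

/-- `S_{i,a}` with `j = i + 1`: the entries `(α_i, α_j)` become `(α_j - a, α_i + a)`. -/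
def straightStep {m : ℕ} (i j : Fin m) (a : ℕ) (α : Fin m → ℤ) : Fin m → ℤ := fun k =>
  if k = i then α j - a else if k = j then α i + a else α k

/-- The coefficient `C(S_{i,a})`, where `d = α_{i+1} - α_i > 0` and `0 ≤ a ≤ ⌊d / 2⌋`. -/
def stepCoeff (d a : ℕ) : F :=
  if a = 0 then t
  else if a < d / 2 then t ^ (a + 1) - t ^ (a - 1)
  else t ^ (a + d % 2) - t ^ (a - 1)

/-- A straightening order: for every integer sequence of length `m` that is not weakly decreasing,
a choice of the adjacent positions `(i, i + 1)` with `α_i < α_{i+1}` to be straightened next. -/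
abbrev StraighteningOrder (m : ℕ) : Type :=
  ∀ α : Fin m → ℤ, ¬ Antitone α →
    {p : Fin m × Fin m // (p.1 : ℕ) + 1 = p.2 ∧ α p.1 < α p.2}

theorem straighteningOrder_nonempty (m : ℕ) : Nonempty (StraighteningOrder m) := by
  classical
  refine ⟨fun α hα => Classical.choice ?_⟩
  by_contra hne
  refine hα ?_
  cases m with
  | zero => exact fun i => i.elim0
  | succ m =>
    rw [Fin.antitone_iff_succ_le]
    intro i
    by_contra hi
    exact hne ⟨⟨(i.castSucc, i.succ), by simp, not_le.mp hi⟩⟩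

/-- A quantity that every straightening step decreases. -/
def disorder {m : ℕ} (α : Fin m → ℤ) : ℕ :=
  (∑ k : Fin m, (k : ℤ) * (α k - ⨅ l, α l)).toNat

theorem disorder_step_lt {m : ℕ} (α : Fin m → ℤ) (i j : Fin m) (hij : (i : ℕ) + 1 = j)
    (h : α i < α j) (a : ℕ) (ha : a ≤ (α j - α i).toNat / 2) :
    disorder (straightStep i j a α) < disorder α := by
  have hne : i ≠ j := by rintro rfl; omega
  have : Nonempty (Fin m) := ⟨i⟩
  have hinf : ∀ k, (⨅ l, α l) ≤ α k := fun k => ciInf_le (Set.finite_range α).bddBelow k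
  have hle : (⨅ l, α l) ≤ ⨅ l, straightStep i j a α l := by
    refine le_ciInf fun k => ?_
    have h1 := hinf i
    unfold straightStep
    split_ifs
    · omega
    · omega
    · exact hinf k
  have hb : ∀ k, (⨅ l, straightStep i j a α l) ≤ straightStep i j a α k :=
    fun k => ciInf_le (Set.finite_range _).bddBelow k
  have hs : ∑ k : Fin m, (k : ℤ) * straightStep i j a α k
      = ∑ k : Fin m, (k : ℤ) * α k + (α i + a - α j) := by
    have e : ∀ k : Fin m, (k : ℤ) * straightStep i j a α k = (k : ℤ) * α k
        + ((if k = i then (k : ℤ) * (α j - a - α i) else 0)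
          + if k = j then (k : ℤ) * (α i + a - α j) else 0) := by
      intro k
      unfold straightStep
      by_cases hi : k = i
      · subst hi; simp [hne]; ring
      · by_cases hj : k = j
        · subst hj; simp [hi]; ring
        · simp [hi, hj]
    simp_rw [e, Finset.sum_add_distrib]
    have hij' : (j : ℤ) = (i : ℤ) + 1 := by exact_mod_cast hij.symm
    simp only [Finset.sum_ite_eq', Finset.mem_univ, if_true, hij']
    ring
  have h2 : ∑ k : Fin m, (k : ℤ) * (straightStep i j a α k - ⨅ l, straightStep i j a α l)
      ≤ ∑ k : Fin m, (k : ℤ) * (straightStep i j a α k - ⨅ l, α l) :=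
    Finset.sum_le_sum fun k _ => mul_le_mul_of_nonneg_left (by linarith) (by positivity)
  have h3 : ∑ k : Fin m, (k : ℤ) * (straightStep i j a α k - ⨅ l, α l)
      < ∑ k : Fin m, (k : ℤ) * (α k - ⨅ l, α l) := by
    simp only [mul_sub, Finset.sum_sub_distrib, hs]
    omega
  have h4 : 0 ≤ ∑ k : Fin m,
      (k : ℤ) * (straightStep i j a α k - ⨅ l, straightStep i j a α l) :=
    Finset.sum_nonneg fun k _ => mul_nonneg (by positivity) (by linarith [hb k])
  unfold disorder
  omega

/-- The straightening coefficient `B(λ, α)`: the sum, over all sequences of steps `S_{i,a}` that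
lead from `α` to the partition `λ` (padded with zeros), of the products of the coefficients
`C(S_{i,a})`, where the position `i` of every step is given by the straightening order `σ`. -/
def straightCoeff {m : ℕ} (σ : StraighteningOrder m) (lam : List ℕ) (α : Fin m → ℤ) : F :=
  open Classical in
  if h : Antitone α then
    if lam.length ≤ m ∧ ∀ i : Fin m, α i = (lam.getD i 0 : ℕ) then 1 else 0
  else
    ∑ a : Fin ((α (σ α h).1.2 - α (σ α h).1.1).toNat / 2 + 1),
      stepCoeff (α (σ α h).1.2 - α (σ α h).1.1).toNat a *
        straightCoeff σ lam (straightStep (σ α h).1.1 (σ α h).1.2 a α)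
termination_by disorder α
decreasing_by exact disorder_step_lt α _ _ (σ α h).2.1 (σ α h).2.2 _ (Nat.lt_succ_iff.mp a.2)

end

end HallLittlewood

namespace HallLittlewood

noncomputable section

/-! ### The bilinear form in terms of coefficients -/

/-! The recursion says that multiplication by `q_k`, with `k = μ_1`, can be moved to the other side
of the form. Its adjoint is computed on `Q_ν`, and the result is rewritten in the functions `Q_λ`.

Multiplication by `p_r` is adjoint to `r / (1 - t^r) · ∂/∂p_r`, and `q_k` represents the functional
taking the coefficient of `v^k` after `p_r ↦ v^r`. Hence the adjoint of `q_k` is the coefficient of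
`v^k` in the translation `p_r ↦ p_r + v^r` (`form_skew`). The translation is a ring homomorphism, so
the adjoint distributes `k` over the factors of a product; on `q_n` it gives `q_{n-k}` times the
coefficient of `v^k` in `(1 - tv)/(1 - v)` (`skew_q`). Lowering indices commutes with the raising
operators, so the adjoint sends `Q_ν` to `∑_τ (1-t)^{l(τ)} Q_{ν-τ}` (`skew_hallQ`).

It remains to straighten `Q_α` for `α = ν - τ`. For adjacent `i, j`, the factor `1 - t R_{ij}`
cancels the denominator belonging to that pair, and what is left apart from `1 - R_{ij}` is
symmetric in the two entries. This yields a four-term relation (`hallQ_exchange`) whose solution by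
recursion has exactly the coefficients `C(S_{i,a})` (`eq_sum_stepCoeff_of_exchange`). Repeated steps
end at weakly decreasing sequences: these give `0` if an entry is negative and some `Q_λ` otherwise.
Each step preserves the bound `α ≤ ν`, so only `λ ⊂ ν` occur (`hallQ_eq_sum_straightCoeff`). -/

/-- The degree of the monomial with exponents `s`, where `p_r` has degree `r`. -/
def wt (s : ℕ+ →₀ ℕ) : ℕ := (partsOfExponents s).sum

/-- `z_λ(t)` for the monomial with exponents `s`. -/
def zExp (s : ℕ+ →₀ ℕ) : F := zt (partsOfExponents s)

theorem one_sub_t_pow_ne_zero {r : ℕ} (hr : 0 < r) : (1 : F) - t ^ r ≠ 0 := by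
  intro h
  have h1 : (RatFunc.X : RatFunc ℚ) ^ r = 1 := (sub_eq_zero.mp h).symm
  rw [← RatFunc.algebraMap_X, ← map_pow, ← map_one (algebraMap (Polynomial ℚ) (RatFunc ℚ))] at h1
  have h2 := RatFunc.algebraMap_injective ℚ h1
  have h3 := congrArg Polynomial.natDegree h2
  simp at h3
  omega

theorem partsOfExponents_eq_map (s : ℕ+ →₀ ℕ) :
    partsOfExponents s = (Finsupp.toMultiset s).map PNat.val := by
  simp only [partsOfExponents, Multiset.map_id', Multiset.bind_def, Multiset.pure_def,
    Multiset.bind_singleton]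

theorem partsOfExponents_add (s u : ℕ+ →₀ ℕ) :
    partsOfExponents (s + u) = partsOfExponents s + partsOfExponents u := by
  simp [partsOfExponents_eq_map]

theorem partsOfExponents_single (r : ℕ+) : partsOfExponents (Finsupp.single r 1) = {(r : ℕ)} := by
  simp [partsOfExponents_eq_map]

theorem count_partsOfExponents (s : ℕ+ →₀ ℕ) (r : ℕ+) :
    (partsOfExponents s).count (r : ℕ) = s r := by
  classical
  rw [partsOfExponents_eq_map, Multiset.count_map_eq_count' PNat.val _ PNat.coe_injective]
  simp

theorem partsOfExponents_injective : Function.Injective partsOfExponents := by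
  intro s u h
  ext r
  rw [← count_partsOfExponents, h, count_partsOfExponents]

theorem pos_of_mem_partsOfExponents {s : ℕ+ →₀ ℕ} {i : ℕ} (h : i ∈ partsOfExponents s) :
    0 < i := by
  rw [partsOfExponents_eq_map] at h
  obtain ⟨r, -, rfl⟩ := Multiset.mem_map.mp h
  exact r.pos

theorem exists_partsOfExponents_eq {m : Multiset ℕ} (h : ∀ i ∈ m, 0 < i) :
    ∃ s, partsOfExponents s = m := by
  induction m using Multiset.induction with
  | empty => exact ⟨0, by simp [partsOfExponents_eq_map]⟩
  | cons a m ih =>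
    obtain ⟨s, hs⟩ := ih fun i hi => h i (Multiset.mem_cons_of_mem hi)
    obtain ⟨r, rfl⟩ : ∃ r : ℕ+, (r : ℕ) = a := ⟨⟨a, h a (Multiset.mem_cons_self a m)⟩, rfl⟩
    refine ⟨s + Finsupp.single r 1, ?_⟩
    rw [partsOfExponents_add, partsOfExponents_single, hs, add_comm, Multiset.singleton_add]

theorem wt_add (s u : ℕ+ →₀ ℕ) : wt (s + u) = wt s + wt u := by
  simp [wt, partsOfExponents_add]

theorem wt_single (r : ℕ+) : wt (Finsupp.single r 1) = r := by
  simp [wt, partsOfExponents_single]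

theorem wt_zero : wt 0 = 0 := by simp [wt, partsOfExponents_eq_map]

theorem wt_eq_sum (s : ℕ+ →₀ ℕ) : wt s = s.sum fun r e => e * (r : ℕ) := by
  induction s using Finsupp.induction_linear with
  | zero => simp [wt_zero]
  | add s u hs hu =>
    rw [wt_add, hs, hu, Finsupp.sum_add_index'] <;> simp [add_mul]
  | single r e => simp [wt, partsOfExponents_eq_map, Multiset.map_nsmul, Multiset.sum_nsmul,
      Finsupp.sum_single_index]

theorem prod_map_powerSum (s : ℕ+ →₀ ℕ) :
    ((partsOfExponents s).map powerSum).prod = MvPolynomial.monomial s 1 := by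
  induction s using Finsupp.induction_linear with
  | zero => simp [partsOfExponents_eq_map]
  | add s u hs hu =>
    rw [partsOfExponents_add, Multiset.map_add, Multiset.prod_add, hs, hu,
      MvPolynomial.monomial_mul, one_mul]
  | single r e =>
    have h : powerSum r = MvPolynomial.X r := dif_pos r.pos
    simp [partsOfExponents_eq_map, h, Multiset.map_nsmul, Multiset.prod_nsmul,
      MvPolynomial.X_pow_eq_monomial]

theorem zt_ne_zero {m : Multiset ℕ} (h : ∀ i ∈ m, 0 < i) : zt m ≠ 0 := by
  unfold zt
  refine div_ne_zero (Finset.prod_ne_zero_iff.mpr fun i hi => mul_ne_zero (pow_ne_zero _ ?_) ?_) ?_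
  · have := h i (Multiset.mem_toFinset.mp hi)
    exact_mod_cast this.ne'
  · exact_mod_cast Nat.factorial_ne_zero _
  · intro h0
    obtain ⟨i, hi, h1⟩ := Multiset.mem_map.mp (Multiset.prod_eq_zero_iff.mp h0)
    exact one_sub_t_pow_ne_zero (h i hi) h1

theorem zExp_ne_zero (s : ℕ+ →₀ ℕ) : zExp s ≠ 0 :=
  zt_ne_zero fun _ => pos_of_mem_partsOfExponents

theorem zt_cons (r : ℕ) (m : Multiset ℕ) :
    zt (r ::ₘ m) = zt m * ((r : F) * ((m.count r : F) + 1)) / (1 - t ^ r) := by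
  have key : ∏ i ∈ (r ::ₘ m).toFinset,
        ((i : F) ^ (r ::ₘ m).count i * (((r ::ₘ m).count i).factorial : F))
      = (∏ i ∈ m.toFinset, ((i : F) ^ m.count i * ((m.count i).factorial : F)))
        * ((r : F) * ((m.count r : F) + 1)) := by
    have e1 : ∏ i ∈ m.toFinset, ((i : F) ^ m.count i * ((m.count i).factorial : F))
        = ∏ i ∈ (r ::ₘ m).toFinset, ((i : F) ^ m.count i * ((m.count i).factorial : F)) := by
      refine Finset.prod_subset (by simp) fun i _ hi => ?_
      rw [Multiset.mem_toFinset] at hi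
      simp [Multiset.count_eq_zero_of_notMem hi]
    have hmem : r ∈ (r ::ₘ m).toFinset := by simp
    rw [e1, ← Finset.mul_prod_erase _ _ hmem, ← Finset.mul_prod_erase _ _ hmem]
    have e2 : ∏ i ∈ (r ::ₘ m).toFinset.erase r,
          ((i : F) ^ (r ::ₘ m).count i * (((r ::ₘ m).count i).factorial : F))
        = ∏ i ∈ (r ::ₘ m).toFinset.erase r,
          ((i : F) ^ m.count i * ((m.count i).factorial : F)) :=
      Finset.prod_congr rfl fun i hi => by
        rw [Multiset.count_cons_of_ne (Finset.ne_of_mem_erase hi)]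
    rw [e2, Multiset.count_cons_self, Nat.factorial_succ]
    push_cast
    ring
  unfold zt
  rw [key, Multiset.map_cons, Multiset.prod_cons, mul_comm (1 - t ^ r), div_mul_eq_div_div]
  ring

/-- This ratio of norms is what makes multiplication by `p_r` adjoint to a multiple of `∂/∂p_r`. -/
theorem zExp_add_single (s : ℕ+ →₀ ℕ) (r : ℕ+) :
    zExp (s + Finsupp.single r 1) = zExp s * ((r : F) * ((s r : F) + 1)) / (1 - t ^ (r : ℕ)) := by
  rw [zExp, partsOfExponents_add, partsOfExponents_single, add_comm, Multiset.singleton_add,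
    zt_cons, count_partsOfExponents, zExp]

theorem form_monomial_left (s : ℕ+ →₀ ℕ) (a : F) (g : V) :
    form (MvPolynomial.monomial s a) g = a * (zExp s * MvPolynomial.coeff s g) := by
  have h : MvPolynomial.monomial s a = a • MvPolynomial.basisMonomials ℕ+ F s := by
    simp [MvPolynomial.smul_monomial]
  rw [h, map_smul, LinearMap.smul_apply, form, Module.Basis.constr_basis]
  simp [zExp]

theorem form_monomial_right (f : V) (s : ℕ+ →₀ ℕ) (a : F) :
    form f (MvPolynomial.monomial s a) = a * (zExp s * MvPolynomial.coeff s f) := by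
  classical
  induction f using MvPolynomial.induction_on' with
  | monomial u b =>
    rw [form_monomial_left, MvPolynomial.coeff_monomial,
      MvPolynomial.coeff_monomial]
    split_ifs with h1 h2 h2
    · subst h1; ring
    · exact absurd h1.symm h2
    · exact absurd h2.symm h1
    · simp
  | add f g hf hg =>
    rw [map_add, LinearMap.add_apply, hf, hg, MvPolynomial.coeff_add]
    ring

/-- The form is diagonal on monomials with nonzero entries, hence nondegenerate. -/
theorem eq_of_form_eq {f g : V} (h : ∀ u, form f u = form g u) : f = g := by
  ext s
  have := h (MvPolynomial.monomial s 1)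
  rw [form_monomial_right, form_monomial_right, one_mul, one_mul] at this
  exact mul_left_cancel₀ (zExp_ne_zero s) this

theorem coeff_q (n : ℕ) (s : ℕ+ →₀ ℕ) :
    MvPolynomial.coeff s (q n) = if wt s = n then (zExp s)⁻¹ else 0 := by
  classical
  have e (lam : Nat.Partition n) :
      MvPolynomial.coeff s ((zt lam.parts)⁻¹ • (lam.parts.map powerSum).prod)
        = if partsOfExponents s = lam.parts then (zExp s)⁻¹ else 0 := by
    obtain ⟨u, hu⟩ := exists_partsOfExponents_eq fun i hi => lam.parts_pos hi
    rw [← hu, prod_map_powerSum, MvPolynomial.coeff_smul, MvPolynomial.coeff_monomial]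
    by_cases h : u = s
    · subst h; simp [zExp]
    · rw [if_neg h, if_neg fun h' => h (partsOfExponents_injective h').symm, smul_zero]
  rw [q, MvPolynomial.coeff_sum, Finset.sum_congr rfl fun lam _ => e lam]
  split_ifs with h
  · let lam : Nat.Partition n := ⟨partsOfExponents s, pos_of_mem_partsOfExponents, h⟩
    rw [Finset.sum_eq_single lam]
    · simp [lam]
    · intro b _ hb
      rw [if_neg]
      exact fun hc => hb (Nat.Partition.ext hc.symm)
    · simp
  · refine Finset.sum_eq_zero fun lam _ => if_neg fun hc => h ?_
    rw [wt, hc, lam.parts_sum]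

theorem q_zero : q 0 = 1 := by
  classical
  ext s
  rw [coeff_q, MvPolynomial.coeff_one]
  by_cases h : s = 0
  · subst h
    simp [wt_zero, zExp, partsOfExponents_eq_map, zt]
  · rw [if_neg, if_neg (Ne.symm h)]
    intro h0
    refine h (partsOfExponents_injective ?_)
    rw [show partsOfExponents 0 = 0 by simp [partsOfExponents_eq_map]]
    refine Multiset.eq_zero_of_forall_notMem fun i hi => ?_
    have h1 := Multiset.single_le_sum (fun _ _ => Nat.zero_le _) i hi
    have h2 := pos_of_mem_partsOfExponents hi
    rw [wt] at h0
    omega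

/-! ### Multiplication by `p_r` and the derivative `∂/∂p_r` are adjoint up to a scalar -/

theorem form_mul_X (f g : V) (r : ℕ+) :
    form f (g * MvPolynomial.X r)
      = (r : F) / (1 - t ^ (r : ℕ)) * form (MvPolynomial.pderiv r f) g := by
  classical
  induction g using MvPolynomial.induction_on' with
  | monomial u b =>
    rw [MvPolynomial.X, MvPolynomial.monomial_mul, form_monomial_right,
      form_monomial_right, zExp_add_single, MvPolynomial.coeff_pderiv]
    ring
  | add g h hg hh =>
    rw [add_mul, map_add, hg, hh, map_add, mul_add]

/-! ### The adjoint of the multiplication by `q_k` -/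

/-- The translation `p_r ↦ p_r + v ^ r`. -/
def translation : V →ₐ[F] Polynomial V :=
  MvPolynomial.aeval fun r : ℕ+ =>
    Polynomial.C (MvPolynomial.X r) + Polynomial.X ^ (r : ℕ)

/-- The adjoint of the multiplication by `q_k`: the coefficient of `v ^ k` in the translation. -/
def skew (k : ℕ) : V →ₗ[F] V where
  toFun f := (translation f).coeff k
  map_add' f g := by simp
  map_smul' a f := by simp

/-- The specialization `p_r ↦ v ^ r`. -/
def principal : V →ₐ[F] Polynomial F :=
  MvPolynomial.aeval fun r : ℕ+ => Polynomial.X ^ (r : ℕ)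

theorem skew_apply (k : ℕ) (f : V) : skew k f = (translation f).coeff k := rfl

theorem skew_C (k : ℕ) (a : F) :
    skew k (MvPolynomial.C a) = if k = 0 then MvPolynomial.C a else 0 := by
  rw [skew_apply, ← MvPolynomial.algebraMap_eq, AlgHom.commutes, Polynomial.algebraMap_apply,
    Polynomial.coeff_C]

theorem skew_mul_X (k : ℕ) (f : V) (r : ℕ+) :
    skew k (f * MvPolynomial.X r) = skew k f * MvPolynomial.X r +
      if (r : ℕ) ≤ k then skew (k - r) f else 0 := by
  have h : translation (MvPolynomial.X r)
      = Polynomial.C (MvPolynomial.X r) + Polynomial.X ^ (r : ℕ) := by simp [translation]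
  rw [skew_apply, map_mul, h, mul_add, Polynomial.coeff_add, Polynomial.coeff_mul_C,
    Polynomial.coeff_mul_X_pow']
  rfl

/-- Translations commute with derivatives. This carries the induction over the factors `p_r` in
`form_skew`. -/
theorem pderiv_skew (k : ℕ) (r : ℕ+) (f : V) :
    MvPolynomial.pderiv r (skew k f) = skew k (MvPolynomial.pderiv r f) := by
  classical
  induction f using MvPolynomial.induction_on generalizing k with
  | C a =>
    rw [skew_C]
    split_ifs <;> simp
  | add f g hf hg => simp only [map_add, hf, hg]
  | mul_X f i ih =>
    rw [skew_mul_X, map_add, MvPolynomial.pderiv_mul, MvPolynomial.pderiv_mul, map_add, ih,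
      skew_mul_X, MvPolynomial.pderiv_X]
    by_cases hi : i = r
    · subst hi
      split_ifs <;> simp [ih]; ring
    · split_ifs <;> simp [ih, Pi.single_eq_of_ne hi]

theorem constantCoeff_skew (k : ℕ) (f : V) :
    MvPolynomial.constantCoeff (skew k f) = (principal f).coeff k := by
  induction f using MvPolynomial.induction_on generalizing k with
  | C a =>
    rw [skew_C, ← MvPolynomial.algebraMap_eq, AlgHom.commutes, ← Polynomial.C_eq_algebraMap,
      Polynomial.coeff_C]
    split_ifs <;> simp
  | add f g hf hg => simp only [map_add, hf, hg, Polynomial.coeff_add]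
  | mul_X f i ih =>
    have h : principal (MvPolynomial.X i) = Polynomial.X ^ (i : ℕ) := by simp [principal]
    rw [skew_mul_X, map_mul, h, Polynomial.coeff_mul_X_pow', map_add, map_mul,
      MvPolynomial.constantCoeff_X, mul_zero, zero_add]
    split_ifs
    · exact ih _
    · simp

theorem principal_monomial (s : ℕ+ →₀ ℕ) (a : F) :
    principal (MvPolynomial.monomial s a) = Polynomial.monomial (wt s) a := by
  rw [principal, MvPolynomial.aeval_monomial, wt_eq_sum, ← Polynomial.C_eq_algebraMap,
    ← Polynomial.C_mul_X_pow_eq_monomial]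
  congr 1
  rw [Finsupp.prod, Finsupp.sum, ← Finset.prod_pow_eq_pow_sum]
  exact Finset.prod_congr rfl fun r _ => by rw [← pow_mul, mul_comm]

/-- The weights `z_λ⁻¹` in `q_k` cancel the norms `z_λ`, so every monomial of degree `k` contributes
just its coefficient. -/
theorem form_q_right (f : V) (k : ℕ) : form f (q k) = (principal f).coeff k := by
  induction f using MvPolynomial.induction_on' with
  | monomial u b =>
    rw [form_monomial_left, principal_monomial, coeff_q, Polynomial.coeff_monomial]
    split_ifs
    · rw [mul_inv_cancel₀ (zExp_ne_zero u), mul_one]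
    · simp
  | add f g hf hg => simp only [map_add, LinearMap.add_apply, hf, hg, Polynomial.coeff_add]

theorem form_q_left (f : V) (k : ℕ) : form (q k) f = (principal f).coeff k := by
  induction f using MvPolynomial.induction_on' with
  | monomial u b =>
    rw [form_monomial_right, principal_monomial, coeff_q, Polynomial.coeff_monomial]
    split_ifs
    · rw [mul_inv_cancel₀ (zExp_ne_zero u), mul_one]
    · simp
  | add f g hf hg => simp only [map_add, hf, hg, Polynomial.coeff_add]

/-- Induction on `g`: for constant `g` both sides evaluate `f` at `p_r ↦ v^r`, and a factor `p_r` of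
`g` moves to the left as a derivative, which commutes with `skew k`. -/
theorem form_skew (k : ℕ) (f g : V) : form (skew k f) g = form f (q k * g) := by
  induction g using MvPolynomial.induction_on generalizing f with
  | C a =>
    have h : form (skew k f) (MvPolynomial.C a)
        = a * MvPolynomial.constantCoeff (skew k f) := by
      rw [MvPolynomial.C_apply, form_monomial_right, MvPolynomial.constantCoeff_eq]
      simp [zExp, partsOfExponents_eq_map, zt]
    rw [h, constantCoeff_skew, mul_comm (q k), ← MvPolynomial.smul_eq_C_mul, map_smul,
      form_q_right, smul_eq_mul]
  | add g h hg hh => rw [mul_add, map_add, map_add, hg, hh]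
  | mul_X g r ih => rw [form_mul_X, pderiv_skew, ih, ← mul_assoc, form_mul_X]

/-! ### The adjoint on the one-row functions -/

/-- This is the logarithmic derivative of `∑ q_n v^n = exp (∑ (1 - t^r) p_r v^r / r)`. On the
monomial with exponents `s`, the term of `p_r` contributes `r s_r / z_s`, and these add up to `wt s
/ z_s`. -/
theorem q_newton (n : ℕ) :
    (n : F) • q n = ∑ r : Fin n, (1 - t ^ ((r : ℕ) + 1)) •
      (q (n - (r + 1)) * MvPolynomial.X (Nat.succPNat r)) := by
  classical
  ext s
  rw [MvPolynomial.coeff_smul, MvPolynomial.coeff_sum, coeff_q]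
  have e (r : Fin n) : MvPolynomial.coeff s ((1 - t ^ ((r : ℕ) + 1)) •
      (q (n - (r + 1)) * MvPolynomial.X (Nat.succPNat r)))
      = if wt s = n then
          ((s (Nat.succPNat r) * (r + 1 : ℕ) : ℕ) : F) * (zExp s)⁻¹ else 0 := by
    rw [MvPolynomial.coeff_smul, MvPolynomial.coeff_mul_X']
    by_cases hs : Nat.succPNat r ∈ s.support
    · rw [if_pos hs]
      obtain ⟨u, rfl⟩ : ∃ u, s = u + Finsupp.single (Nat.succPNat r) 1 := by
        refine ⟨s - Finsupp.single (Nat.succPNat r) 1, (tsub_add_cancel_of_le ?_).symm⟩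
        rw [Finsupp.single_le_iff]
        exact Nat.one_le_iff_ne_zero.mpr (Finsupp.mem_support_iff.mp hs)
      rw [add_tsub_cancel_right, coeff_q, wt_add, wt_single, Nat.succPNat_coe, zExp_add_single]
      have hr := r.2
      have hne : (1 : F) - t ^ ((r : ℕ) + 1) ≠ 0 := one_sub_t_pow_ne_zero (Nat.succ_pos _)
      have hz := zExp_ne_zero u
      have h1 : ((r : ℕ) : F) + 1 ≠ 0 := by norm_cast
      have h2 : (u (Nat.succPNat r) : F) + 1 ≠ 0 := by norm_cast
      by_cases hn : wt u = n - (r + 1)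
      · rw [if_pos hn, if_pos (by simp; omega)]
        simp only [Nat.succPNat_coe, Finsupp.add_apply, Finsupp.single_eq_same, smul_eq_mul,
          Nat.succ_eq_add_one]
        push_cast
        field_simp
      · rw [if_neg hn, if_neg (by simp; omega), smul_zero]
    · rw [if_neg hs, Finsupp.notMem_support_iff.mp hs]
      simp
  rw [Finset.sum_congr rfl fun r _ => e r]
  split_ifs with h
  · rw [← Finset.sum_mul, smul_eq_mul, ← Nat.cast_sum]
    congr 2
    subst h
    have hinj : Function.Injective fun r : Fin (wt s) => Nat.succPNat r := fun a b hab =>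
      Fin.ext (Nat.succPNat_injective hab)
    have himage := Finset.sum_image (s := Finset.univ) (f := fun r : ℕ+ => s r * (r : ℕ))
      (g := fun r : Fin (wt s) => Nat.succPNat r) hinj.injOn
    simp only [Nat.succPNat_coe, Nat.succ_eq_add_one] at himage
    rw [← himage]
    conv_lhs => rw [wt_eq_sum, Finsupp.sum]
    -- A part that occurs in `s` is at most `wt s`, so it is among the indices; the other indices
    -- contribute zero.
    refine Finset.sum_subset (fun r hr => ?_) fun r _ hr => ?_
    · have h1 : (r : ℕ) ≤ wt s := by
        rw [wt_eq_sum, Finsupp.sum]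
        refine le_trans ?_ (Finset.single_le_sum (fun _ _ => Nat.zero_le _) hr)
        exact Nat.le_mul_of_pos_left _ (Nat.pos_of_ne_zero (Finsupp.mem_support_iff.mp hr))
      have h2 := r.pos
      refine Finset.mem_image.mpr ⟨⟨r.natPred, by rw [← PNat.natPred_add_one r] at h1; omega⟩,
        Finset.mem_univ _, PNat.succPNat_natPred r⟩
    · rw [Finsupp.notMem_support_iff.mp hr, zero_mul]
  · simp

/-- The coefficient of `v ^ k` in `(1 - t v) / (1 - v)`. -/
def skewCoeff (k : ℕ) : F := if k = 0 then 1 else 1 - t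

theorem sum_one_sub_t_pow_mul_skewCoeff (n : ℕ) :
    ∑ r : Fin n, (1 - t ^ ((r : ℕ) + 1)) * skewCoeff (n - (r + 1)) = n * skewCoeff n := by
  cases n with
  | zero => simp
  | succ m =>
    have h (k : ℕ) : ∑ r : Fin k, (1 - t ^ ((r : ℕ) + 1)) * (1 - t)
        = k * (1 - t) - t + t ^ (k + 1) := by
      induction k with
      | zero => simp
      | succ k ih =>
        rw [Fin.sum_univ_castSucc]
        simp only [Fin.val_castSucc, Fin.val_last]
        rw [ih]
        push_cast
        ring
    have h1 (r : Fin m) : skewCoeff (m + 1 - ((r.castSucc : ℕ) + 1)) = 1 - t := by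
      rw [skewCoeff, if_neg]
      have := r.2
      simp only [Fin.val_castSucc]
      omega
    rw [Fin.sum_univ_castSucc]
    simp only [h1, Fin.val_last, Nat.sub_self]
    simp only [Fin.val_castSucc]
    rw [h, skewCoeff, skewCoeff, if_pos rfl, if_neg (Nat.succ_ne_zero m)]
    push_cast
    ring

/-- Both sides satisfy the recursion of `q_newton`, which determines the value for `k > 0` because
`k` is invertible in `F`. -/
theorem principal_q (k : ℕ) : principal (q k) = Polynomial.monomial k (skewCoeff k) := by
  induction k using Nat.strong_induction_on with
  | _ k ih =>
    rcases Nat.eq_zero_or_pos k with rfl | hk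
    · rw [q_zero, map_one, skewCoeff, if_pos rfl, Polynomial.monomial_zero_left, map_one]
    have hk' : (k : F) ≠ 0 := by exact_mod_cast hk.ne'
    have h := congrArg principal (q_newton k)
    rw [map_smul, map_sum] at h
    have e (r : Fin k) : principal ((1 - t ^ ((r : ℕ) + 1)) •
        (q (k - (r + 1)) * MvPolynomial.X (Nat.succPNat r)))
        = Polynomial.monomial k ((1 - t ^ ((r : ℕ) + 1)) * skewCoeff (k - (r + 1))) := by
      have hr := r.2
      have hX : principal (MvPolynomial.X (Nat.succPNat r)) = Polynomial.X ^ ((r : ℕ) + 1) := by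
        simp [principal]
      rw [map_smul, map_mul, ih _ (by omega), hX, Polynomial.monomial_mul_X_pow,
        Polynomial.smul_monomial, smul_eq_mul, Nat.sub_add_cancel (by omega)]
    rw [Finset.sum_congr rfl fun r _ => e r, ← map_sum, sum_one_sub_t_pow_mul_skewCoeff,
      ← smul_eq_mul, ← Polynomial.smul_monomial] at h
    exact smul_right_injective _ hk' h

/-- Pairing with any `g` turns the left side into the coefficient of `v^n` in `principal (q k) *
principal g`, where the first factor is a single monomial. -/
theorem skew_q (k n : ℕ) :
    skew k (q n) = if k ≤ n then skewCoeff k • q (n - k) else 0 := by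
  refine eq_of_form_eq fun g => ?_
  rw [form_skew, form_q_left, map_mul, principal_q, ← Polynomial.C_mul_X_pow_eq_monomial,
    mul_assoc, Polynomial.coeff_C_mul, Polynomial.coeff_X_pow_mul']
  split_ifs
  · rw [map_smul, LinearMap.smul_apply, form_q_left, smul_eq_mul]
  · simp

theorem skew_qInt (k : ℕ) (a : ℤ) : skew k (qInt a) = skewCoeff k • qInt (a - k) := by
  unfold qInt
  by_cases ha : 0 ≤ a
  · rw [if_pos ha, skew_q]
    by_cases hk : k ≤ a.toNat
    · rw [if_pos hk, if_pos (by omega), show (a - k).toNat = a.toNat - k by omega]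
    · rw [if_neg hk, if_neg (by omega), smul_zero]
  · rw [if_neg ha, if_neg (by omega), map_zero, smul_zero]

theorem skew_prod {ι : Type*} [DecidableEq ι] (s : Finset ι) (k : ℕ) (f : ι → V) :
    skew k (∏ i ∈ s, f i) = ∑ τ ∈ s.piAntidiag k, ∏ i ∈ s, skew (τ i) (f i) := by
  -- The coefficient formula for a product is taken from power series, so the polynomials are
  -- embedded there.
  have h : skew k (∏ i ∈ s, f i)
      = PowerSeries.coeff k (∏ i ∈ s, (translation (f i) : PowerSeries V)) := by
    rw [skew_apply, map_prod, ← Polynomial.coeff_coe,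
      ← Polynomial.coeToPowerSeries.ringHom_apply, map_prod]
    rfl
  rw [h, PowerSeries.coeff_prod]
  refine Finset.sum_bij (fun τ _ => ⇑τ) (fun τ hτ => ?_) (fun _ _ _ _ h => DFunLike.coe_injective h)
    (fun τ hτ => ?_) fun τ _ => ?_
  · rw [Finset.mem_finsuppAntidiag] at hτ
    rw [Finset.mem_piAntidiag]
    exact ⟨hτ.1, fun i hi => hτ.2 (Finsupp.mem_support_iff.mpr hi)⟩
  · rw [Finset.mem_piAntidiag] at hτ
    refine ⟨Finsupp.onFinset s τ hτ.2, ?_, rfl⟩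
    rw [Finset.mem_finsuppAntidiag]
    exact ⟨hτ.1, Finsupp.support_onFinset_subset⟩
  · simp [skew_apply]

/-! ### Series in the raising operators -/

/-- The series `∑_k C(k) ∏_{i < j} R_{ij} ^ {k_{ij}}` in the raising operators, applied
to `q_α`. -/
def raisingSeries {m : ℕ} (C : (Pairs m → ℕ) → F) (α : Fin m → ℤ) : V :=
  ∑ᶠ k : Pairs m → ℕ, C k • ∏ i, qInt (raise k α i)

theorem qInt_of_neg {a : ℤ} (h : a < 0) : qInt a = 0 := if_neg (not_le.mpr h)

theorem raisingSeries_support_finite {m : ℕ} (C : (Pairs m → ℕ) → F) (α : Fin m → ℤ) :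
    (Function.support fun k => C k • ∏ i, qInt (raise k α i)).Finite := by
  classical
  refine (Finset.finite_toSet
    (Fintype.piFinset fun _ : Pairs m => Finset.range ((∑ i, |α i|).toNat + 1))).subset ?_
  intro k hk
  have h : ∀ i, 0 ≤ raise k α i := by
    by_contra hc
    push Not at hc
    obtain ⟨i, hi⟩ := hc
    refine hk ?_
    simp only
    rw [Finset.prod_eq_zero (Finset.mem_univ i) (qInt_of_neg hi), smul_zero]
  simp only [Finset.mem_coe, Fintype.mem_piFinset, Finset.mem_range]
  intro p
  have := raise_nonneg_bound α k h p
  omega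

theorem hallQ_eq_raisingSeries {m : ℕ} (α : Fin m → ℤ) :
    hallQ α = raisingSeries (fun k => ∏ p, raisingCoeff (k p)) α := rfl

theorem raisingSeries_sub {m : ℕ} (C D : (Pairs m → ℕ) → F) (α : Fin m → ℤ) :
    raisingSeries (fun k => C k - D k) α = raisingSeries C α - raisingSeries D α := by
  unfold raisingSeries
  rw [← finsum_sub_distrib (raisingSeries_support_finite C α) (raisingSeries_support_finite D α)]
  simp only [sub_smul]

theorem raisingSeries_smul {m : ℕ} (a : F) (C : (Pairs m → ℕ) → F) (α : Fin m → ℤ) :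
    raisingSeries (fun k => a * C k) α = a • raisingSeries C α := by
  unfold raisingSeries
  rw [smul_finsum]
  simp only [mul_smul]

theorem finsum_comp_of_injective {α β M : Type*} [AddCommMonoid M] {g : β → α}
    (hg : Function.Injective g) {f : α → M} (h : Function.support f ⊆ Set.range g) :
    ∑ᶠ j, f (g j) = ∑ᶠ i, f i := by
  rw [← finsum_mem_range hg, finsum_mem_def, Set.indicator_eq_self.mpr h]

theorem raise_add {m : ℕ} (k l : Pairs m → ℕ) (α : Fin m → ℤ) :
    raise k (raise l α) = raise (k + l) α := by
  ext i
  have h (f : Pairs m → Fin m) : (∑ p : Pairs m, if f p = i then (((k + l) p : ℕ) : ℤ) else 0)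
      = (∑ p : Pairs m, if f p = i then (k p : ℤ) else 0)
        + ∑ p : Pairs m, if f p = i then (l p : ℤ) else 0 := by
    rw [← Finset.sum_add_distrib]
    refine Finset.sum_congr rfl fun p _ => ?_
    split_ifs <;> simp
  simp only [raise, h]
  ring

theorem raise_sub {m : ℕ} (k : Pairs m → ℕ) (α β : Fin m → ℤ) (i : Fin m) :
    raise k (fun i => α i - β i) i = raise k α i - β i := by
  simp only [raise]
  ring

/-- Raising operators and the subtraction of `τ` are both translations of the index, so they commute
and the adjoint can be applied term by term. A nonzero entry of `τ` contributes `1 - t`, a zero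
entry `1`. -/
theorem skew_hallQ {m : ℕ} (K : ℕ) (α : Fin m → ℤ) :
    skew K (hallQ α) = ∑ τ ∈ (Finset.univ : Finset (Fin m)).piAntidiag K,
      (1 - t) ^ (Finset.univ.filter fun i => τ i ≠ 0).card • hallQ fun i => α i - (τ i : ℤ) := by
  have hcoeff (τ : Fin m → ℕ) : ∏ i, skewCoeff (τ i)
      = (1 - t) ^ (Finset.univ.filter fun i => τ i ≠ 0).card := by
    rw [← Finset.prod_const, Finset.prod_filter]
    exact Finset.prod_congr rfl fun i _ => by by_cases h : τ i = 0 <;> simp [skewCoeff, h]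
  have e (k : Pairs m → ℕ) : skew K (raisingTerm α k)
      = ∑ τ ∈ (Finset.univ : Finset (Fin m)).piAntidiag K,
        ((1 - t) ^ (Finset.univ.filter fun i => τ i ≠ 0).card •
          raisingTerm (fun i => α i - (τ i : ℤ)) k) := by
    rw [raisingTerm, map_smul, skew_prod, Finset.smul_sum]
    refine Finset.sum_congr rfl fun τ _ => ?_
    simp only [skew_qInt, raisingTerm, raise_sub]
    rw [← hcoeff, smul_comm]
    congr 1
    simp only [MvPolynomial.smul_eq_C_mul, Finset.prod_mul_distrib, map_prod]
  rw [hallQ, ← LinearMap.toAddMonoidHom_coe, AddMonoidHom.map_finsum _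
    (raisingTerm_support_finite α), LinearMap.toAddMonoidHom_coe, finsum_congr e,
    finsum_sum_comm]
  · refine Finset.sum_congr rfl fun τ _ => ?_
    rw [← smul_finsum]
    rfl
  · intro τ _
    refine (raisingTerm_support_finite fun i => α i - (τ i : ℤ)).subset fun k hk h0 => hk ?_
    simp only [h0, smul_zero]

/-! ### The exchange relation for adjacent entries -/

theorem raisingSeries_raise {m : ℕ} (p₀ : Pairs m) (C : (Pairs m → ℕ) → F) (α : Fin m → ℤ) :
    raisingSeries C (raise (Pi.single p₀ 1) α)
      = raisingSeries (fun k => if k p₀ = 0 then 0 else C (k - Pi.single p₀ 1)) α := by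
  unfold raisingSeries
  refine Eq.trans ?_ (finsum_comp_of_injective (g := fun k : Pairs m → ℕ => k + Pi.single p₀ 1)
    (add_left_injective _) ?_)
  · refine finsum_congr fun k => ?_
    have h0 : (k + Pi.single p₀ 1 : Pairs m → ℕ) p₀ ≠ 0 := by simp
    rw [raise_add]
    simp only [if_neg h0, add_tsub_cancel_right]
  · intro k hk
    refine ⟨k - Pi.single p₀ 1, tsub_add_cancel_of_le ?_⟩
    intro p
    by_cases hp : p = p₀
    · subst hp
      rw [Pi.single_eq_same, Nat.one_le_iff_ne_zero]
      intro h0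
      exact hk (by simp [h0])
    · simp [Pi.single_eq_of_ne hp]

/-- The coefficients of `∏ (1 - R_{ij}) / (1 - t R_{ij})` over all pairs but `p₀`. -/
def coeffExcept {m : ℕ} (p₀ : Pairs m) (k : Pairs m → ℕ) : F :=
  if k p₀ = 0 then ∏ p, raisingCoeff (k p) else 0

/-- This is `(1 - tR) · (1 - R)/(1 - tR) = 1 - R` for the operator `R` of the pair `p₀`, the other
factors being left alone. -/
theorem hallQ_sub_t_smul_hallQ_raise {m : ℕ} (p₀ : Pairs m) (α : Fin m → ℤ) :
    hallQ α - t • hallQ (raise (Pi.single p₀ 1) α)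
      = raisingSeries (coeffExcept p₀) α
        - raisingSeries (coeffExcept p₀) (raise (Pi.single p₀ 1) α) := by
  simp only [hallQ_eq_raisingSeries]
  rw [raisingSeries_raise, raisingSeries_raise, ← raisingSeries_smul, ← raisingSeries_sub,
    ← raisingSeries_sub]
  congr 1
  ext k
  by_cases hk : k p₀ = 0
  · simp [hk, coeffExcept]
  · rw [if_neg hk, if_neg hk, coeffExcept, if_neg hk, coeffExcept]
    have hne (p : Pairs m) (hp : p ≠ p₀) : (k - Pi.single p₀ 1 : Pairs m → ℕ) p = k p := by
      simp [Pi.single_eq_of_ne hp]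
    have hs : (k - Pi.single p₀ 1 : Pairs m → ℕ) p₀ = k p₀ - 1 := by simp
    have hprod : ∏ p ∈ Finset.univ.erase p₀,
          raisingCoeff ((k - Pi.single p₀ 1 : Pairs m → ℕ) p)
        = ∏ p ∈ Finset.univ.erase p₀, raisingCoeff (k p) :=
      Finset.prod_congr rfl fun p hp => by rw [hne p (Finset.ne_of_mem_erase hp)]
    rw [← Finset.mul_prod_erase _ _ (Finset.mem_univ p₀),
      ← Finset.mul_prod_erase _ _ (Finset.mem_univ p₀), hprod, hs]
    obtain ⟨e, he⟩ := Nat.exists_eq_succ_of_ne_zero hk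
    rw [he, Nat.succ_sub_one]
    -- For exponent `1` the constant coefficient of `(1 - R)/(1 - tR)` enters and `-1` survives; for
    -- higher exponents the terms cancel.
    rcases Nat.eq_zero_or_pos e with rfl | hpos
    · simp [raisingCoeff]
      ring
    · obtain ⟨e, rfl⟩ := Nat.exists_eq_succ_of_ne_zero hpos.ne'
      simp [raisingCoeff]
      ring

theorem swap_lt_swap {m : ℕ} {i j : Fin m} (hij : (i : ℕ) + 1 = j) {x y : Fin m} (h : x < y)
    (hne : ¬ (x = i ∧ y = j)) : Equiv.swap i j x < Equiv.swap i j y := by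
  simp only [Equiv.swap_apply_def]
  split_ifs <;> simp only [Fin.lt_def, Fin.ext_iff] at * <;> omega

/-- The action of the transposition of adjacent positions `i`, `j` on the pairs other
than `(i, j)`. -/
def swapPairs {m : ℕ} {i j : Fin m} (hij : (i : ℕ) + 1 = j) (p : Pairs m) : Pairs m :=
  if h : p.1.1 = i ∧ p.1.2 = j then p
  else ⟨(Equiv.swap i j p.1.1, Equiv.swap i j p.1.2), swap_lt_swap hij p.2 h⟩

theorem swapPairs_involutive {m : ℕ} {i j : Fin m} (hij : (i : ℕ) + 1 = j) :
    Function.Involutive (swapPairs hij) := by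
  intro p
  by_cases h : p.1.1 = i ∧ p.1.2 = j
  · simp [swapPairs, h]
  · have h' : ¬ (Equiv.swap i j p.1.1 = i ∧ Equiv.swap i j p.1.2 = j) := by
      rintro ⟨h1, h2⟩
      rw [Equiv.swap_apply_eq_iff, Equiv.swap_apply_left] at h1
      rw [Equiv.swap_apply_eq_iff, Equiv.swap_apply_right] at h2
      have := p.2
      rw [h1, h2, Fin.lt_def] at this
      omega
    have e : swapPairs hij p
        = ⟨(Equiv.swap i j p.1.1, Equiv.swap i j p.1.2), swap_lt_swap hij p.2 h⟩ := dif_neg h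
    rw [e, swapPairs, dif_neg h']
    ext <;> simp

/-- Transposing adjacent positions permutes the pairs other than `(i, j)` without reversing any of
them, so the remaining product of operators is invariant; the factors `q` commute. -/
theorem raisingSeries_coeffExcept_swap {m : ℕ} {i j : Fin m} (hij : (i : ℕ) + 1 = j)
    (hlt : i < j) (α : Fin m → ℤ) :
    raisingSeries (coeffExcept ⟨(i, j), hlt⟩) (fun x => α (Equiv.swap i j x))
      = raisingSeries (coeffExcept ⟨(i, j), hlt⟩) α := by
  let w : Pairs m ≃ Pairs m := (swapPairs_involutive hij).toPerm
  have hw (p : Pairs m) : w p = swapPairs hij p := rfl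
  have hp₀ : w ⟨(i, j), hlt⟩ = ⟨(i, j), hlt⟩ := by simp [hw, swapPairs]
  unfold raisingSeries
  rw [← finsum_comp_equiv (w.arrowCongr (Equiv.refl ℕ))]
  refine finsum_congr fun k => ?_
  have hk (p : Pairs m) : (w.arrowCongr (Equiv.refl ℕ)) k p = k (w p) := rfl
  by_cases h0 : k ⟨(i, j), hlt⟩ = 0
  · have hr (x : Fin m) : raise ((w.arrowCongr (Equiv.refl ℕ)) k)
        (fun x => α (Equiv.swap i j x)) x = raise k α (Equiv.swap i j x) := by
      have aux (f : Fin m × Fin m → Fin m)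
          (hf : ∀ p : Pairs m, p ≠ ⟨(i, j), hlt⟩ → f (w p).1 = Equiv.swap i j (f p.1)) :
          (∑ p : Pairs m, if f p.1 = x then (k (w p) : ℤ) else 0)
            = ∑ p : Pairs m, if f p.1 = Equiv.swap i j x then (k p : ℤ) else 0 := by
        refine Fintype.sum_equiv w _ _ fun p => ?_
        by_cases hp : p = ⟨(i, j), hlt⟩
        · rw [hp, hp₀, h0]
          simp
        · rw [hf p hp]
          simp
      have hne (p : Pairs m) (hp : p ≠ ⟨(i, j), hlt⟩) : ¬ (p.1.1 = i ∧ p.1.2 = j) :=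
        fun h => hp (Subtype.ext (Prod.ext h.1 h.2))
      simp only [raise, hk]
      rw [aux Prod.fst fun p hp => by rw [hw, swapPairs, dif_neg (hne p hp)],
        aux Prod.snd fun p hp => by rw [hw, swapPairs, dif_neg (hne p hp)]]
    rw [coeffExcept, hk, hp₀, if_pos h0, coeffExcept, if_pos h0]
    congr 1
    · exact Fintype.prod_equiv w _ _ fun p => by rw [hk]
    · exact Fintype.prod_equiv (Equiv.swap i j) _ _ fun x => by rw [hr]
  · rw [coeffExcept, hk, hp₀, if_neg h0, coeffExcept, if_neg h0, zero_smul, zero_smul]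

/-- The sequence `α` with its entries at `i`, `j` replaced by `a`, `b`. -/
def setPair {m : ℕ} (i j : Fin m) (α : Fin m → ℤ) (a b : ℤ) : Fin m → ℤ := fun k =>
  if k = i then a else if k = j then b else α k

/-- With `E` the symmetric series that omits the pair, the two halves are `E(a, b) - E(a+1, b-1)`
and `E(b-1, a+1) - E(b, a)`, which cancel. -/
theorem hallQ_exchange {m : ℕ} {i j : Fin m} (hij : (i : ℕ) + 1 = j) (α : Fin m → ℤ) (a b : ℤ) :
    hallQ (setPair i j α a b) - t • hallQ (setPair i j α (a + 1) (b - 1))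
      + (hallQ (setPair i j α (b - 1) (a + 1)) - t • hallQ (setPair i j α b a)) = 0 := by
  have hlt : i < j := by rw [Fin.lt_def]; omega
  have hraise (a b : ℤ) : raise (Pi.single (⟨(i, j), hlt⟩ : Pairs m) 1) (setPair i j α a b)
      = setPair i j α (a + 1) (b - 1) := by
    have aux (f : Fin m × Fin m → Fin m) (k : Fin m) :
        (∑ p : Pairs m, if f p.1 = k then
          ((Pi.single (⟨(i, j), hlt⟩ : Pairs m) 1 : Pairs m → ℕ) p : ℤ) else 0)
          = if f (i, j) = k then 1 else 0 := by
      rw [Finset.sum_eq_single (⟨(i, j), hlt⟩ : Pairs m)]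
      · simp
      · intro p _ hp
        simp [Pi.single_eq_of_ne hp]
      · simp
    ext k
    simp only [raise]
    rw [aux Prod.fst, aux Prod.snd]
    simp only [setPair]
    by_cases hi : k = i
    · subst hi; simp [hlt.ne']
    · by_cases hj : k = j
      · subst hj; simp [hi, hlt.ne]
      · simp [hi, hj, Ne.symm hi, Ne.symm hj]
  have hswap (a b : ℤ) : raisingSeries (coeffExcept ⟨(i, j), hlt⟩) (setPair i j α b a)
      = raisingSeries (coeffExcept ⟨(i, j), hlt⟩) (setPair i j α a b) := by
    rw [← raisingSeries_coeffExcept_swap hij hlt (setPair i j α a b)]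
    congr 1
    ext k
    simp only [setPair, Equiv.swap_apply_def]
    by_cases hi : k = i
    · simp [hi, hlt.ne']
    · by_cases hj : k = j
      · simp [hj, hlt.ne']
      · simp [hi, hj]
  have h1 := hallQ_sub_t_smul_hallQ_raise ⟨(i, j), hlt⟩ (setPair i j α a b)
  have h2 := hallQ_sub_t_smul_hallQ_raise ⟨(i, j), hlt⟩ (setPair i j α (b - 1) (a + 1))
  rw [hraise] at h1 h2
  rw [sub_add_cancel, add_sub_cancel_right] at h2
  rw [h1, h2, hswap a b, hswap (a + 1) (b - 1)]
  abel

/-! ### Straightening -/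

theorem stepCoeff_zero (d : ℕ) : stepCoeff d 0 = t := if_pos rfl

theorem stepCoeff_succ_of_lt {d a : ℕ} (h : a + 1 < d / 2) :
    stepCoeff d (a + 1) = t ^ (a + 2) - t ^ a := by
  rw [stepCoeff, if_neg (Nat.succ_ne_zero a), if_pos h, Nat.add_sub_cancel]

theorem stepCoeff_succ_of_not_lt {d a : ℕ} (h : ¬ a + 1 < d / 2) :
    stepCoeff d (a + 1) = t ^ (a + 1 + d % 2) - t ^ a := by
  rw [stepCoeff, if_neg (Nat.succ_ne_zero a), if_neg h, Nat.add_sub_cancel]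

/-- The relation expresses `G a b` through `G b a`, `G (b-1) (a+1)` and `t • G (a+1) (b-1)`. The
last has difference `d - 2` and is expanded by induction: its leading coefficient `t * t` joins the
`-1` of `G (b-1) (a+1)`, and its other coefficients are multiplied by `t`. -/
theorem eq_sum_stepCoeff_of_exchange {M : Type*} [AddCommGroup M] [Module F M] {G : ℤ → ℤ → M}
    (hG : ∀ a b, G a b - t • G (a + 1) (b - 1) + (G (b - 1) (a + 1) - t • G b a) = 0)
    (d : ℕ) (hd : 0 < d) (a b : ℤ) (hab : b - a = d) :
    G a b = ∑ x ∈ Finset.range (d / 2 + 1), stepCoeff d x • G (b - x) (a + x) := by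
  induction d using Nat.strong_induction_on generalizing a b with
  | _ d ih =>
    have h := hG a b
    -- The induction needs `d - 2 > 0`, so `d = 1` and `d = 2` are base cases. For `d = 1` the
    -- relation holds doubled and is divided by `2`.
    obtain rfl | rfl | ⟨e, rfl⟩ : d = 1 ∨ d = 2 ∨ ∃ e, d = e + 1 + 2 := by
      rcases d with _ | _ | _ | d
      · omega
      · exact Or.inl rfl
      · exact Or.inr (Or.inl rfl)
      · exact Or.inr (Or.inr ⟨d, rfl⟩)
    · obtain rfl : b = a + 1 := by push_cast at hab; omega
      simp only [add_sub_cancel_right] at h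
      have h2 : (2 : F) • (G a (a + 1) - t • G (a + 1) a) = 0 := by
        rw [two_smul, h]
      have h3 := (smul_eq_zero.mp h2).resolve_left two_ne_zero
      simpa [stepCoeff] using sub_eq_zero.mp h3
    · obtain rfl : b = a + 2 := by push_cast at hab; omega
      rw [show a + 2 - 1 = a + 1 by ring] at h
      have h1 : stepCoeff 2 1 = t - 1 := by
        rw [stepCoeff_succ_of_not_lt (by norm_num)]
        simp
      rw [show 2 / 2 + 1 = 2 from rfl, Finset.sum_range_succ, Finset.sum_range_one,
        stepCoeff_zero, h1, Nat.cast_zero, Nat.cast_one, sub_zero, add_zero,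
        show a + 2 - 1 = a + 1 by ring, sub_smul, one_smul, ← sub_eq_zero, ← h]
      abel
    · have ih' := ih (e + 1) (by omega) (by omega) (a + 1) (b - 1) (by push_cast at hab ⊢; omega)
      rw [show (e + 1 + 2) / 2 + 1 = (e + 1) / 2 + 1 + 1 by omega, Finset.sum_range_succ',
        Finset.sum_range_succ']
      rw [Finset.sum_range_succ'] at ih'
      have e1 (x : ℕ) : stepCoeff (e + 1 + 2) (x + 1 + 1) = t * stepCoeff (e + 1) (x + 1) := by
        by_cases hx : x + 1 < (e + 1) / 2
        · rw [stepCoeff_succ_of_lt hx, stepCoeff_succ_of_lt (by omega)]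
          ring
        · rw [stepCoeff_succ_of_not_lt hx, stepCoeff_succ_of_not_lt (by omega),
            Nat.add_mod_right]
          ring
      have e2 : stepCoeff (e + 1 + 2) (0 + 1) = t * t - 1 := by
        by_cases h1 : 0 + 1 < (e + 1 + 2) / 2
        · rw [stepCoeff_succ_of_lt h1]
          ring
        · rw [stepCoeff_succ_of_not_lt h1, show (e + 1 + 2) % 2 = 1 by omega]
          ring
      have e4 (x : ℕ) : G (b - ((x + 1 + 1 : ℕ) : ℤ)) (a + ((x + 1 + 1 : ℕ) : ℤ))
          = G (b - 1 - ((x + 1 : ℕ) : ℤ)) (a + 1 + ((x + 1 : ℕ) : ℤ)) := by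
        congr 1 <;> push_cast <;> ring
      simp only [e1, e4, mul_smul]
      rw [← Finset.smul_sum, e2, stepCoeff_zero]
      rw [stepCoeff_zero] at ih'
      simp only [Nat.cast_zero, sub_zero, add_zero, zero_add, Nat.cast_one] at ih' ⊢
      rw [← sub_eq_iff_eq_add] at ih'
      rw [← ih', smul_sub, sub_smul, mul_smul, one_smul]
      rw [← sub_eq_zero, ← h]
      abel

/-! ### Sequences whose last entry is negative or zero -/

theorem sum_ite_fst_last {m : ℕ} (k : Pairs (m + 1) → ℕ) :
    (∑ p : Pairs (m + 1), if p.1.1 = Fin.last m then (k p : ℤ) else 0) = 0 :=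
  Finset.sum_eq_zero fun p _ => if_neg fun h =>
    absurd p.2 (by rw [h]; exact not_lt.mpr (Fin.le_last _))

/-- The last entry is negative too, and operators can only lower it, so every term contains a `q` of
negative index. -/
theorem hallQ_eq_zero_of_antitone {m : ℕ} {α : Fin m → ℤ} (h : Antitone α) {i : Fin m}
    (hi : α i < 0) : hallQ α = 0 := by
  cases m with
  | zero => exact i.elim0
  | succ m =>
    have e (k : Pairs (m + 1) → ℕ) : raisingTerm α k = 0 := by
      have h1 := h (Fin.le_last i)
      have h2 : 0 ≤ ∑ p : Pairs (m + 1), if p.1.2 = Fin.last m then (k p : ℤ) else 0 :=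
        Finset.sum_nonneg fun p _ => by split_ifs <;> simp
      rw [raisingTerm, Finset.prod_eq_zero (Finset.mem_univ (Fin.last m)), smul_zero]
      refine qInt_of_neg ?_
      rw [raise, sum_ite_fst_last]
      omega
    rw [hallQ, finsum_congr e, finsum_zero]

/-- The pairs among the first `m` of `m + 1` positions. -/
def pairsCastSucc {m : ℕ} (p : Pairs m) : Pairs (m + 1) :=
  ⟨(p.1.1.castSucc, p.1.2.castSucc), p.2⟩

/-- A pair of positions either avoids the last position or contains it as second entry. -/
def pairsSuccEquiv (m : ℕ) : Pairs m ⊕ Fin m ≃ Pairs (m + 1) :=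
  Equiv.ofBijective
    (Sum.elim pairsCastSucc fun i => ⟨(i.castSucc, Fin.last m), Fin.castSucc_lt_last i⟩) <| by
  refine ⟨?_, ?_⟩
  · rintro (⟨⟨a, b⟩, h⟩ | a) (⟨⟨c, d⟩, h'⟩ | c) he
    · simpa [pairsCastSucc] using he
    · have := congrArg (fun p : Pairs (m + 1) => (p.1.2 : ℕ)) he
      simp [pairsCastSucc] at this
      omega
    · have := congrArg (fun p : Pairs (m + 1) => (p.1.2 : ℕ)) he
      simp [pairsCastSucc] at this
      omega
    · simpa using he
  · rintro ⟨⟨a, b⟩, h⟩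
    obtain ⟨a, rfl⟩ : ∃ a', a = Fin.castSucc a' :=
      ⟨a.castPred (ne_of_lt (lt_of_lt_of_le h (Fin.le_last b))), by simp⟩
    rcases Fin.eq_castSucc_or_eq_last b with ⟨b, rfl⟩ | rfl
    · exact ⟨Sum.inl ⟨(a, b), by simpa using h⟩, rfl⟩
    · exact ⟨Sum.inr a, rfl⟩

theorem pairsSuccEquiv_inl {m : ℕ} (p : Pairs m) :
    pairsSuccEquiv m (Sum.inl p) = pairsCastSucc p := rfl

/-- Exponents for the pairs among `m` positions, extended by zero to `m + 1` positions. -/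
def extendExponents {m : ℕ} (k : Pairs m → ℕ) : Pairs (m + 1) → ℕ :=
  fun p => Sum.elim k (fun _ => 0) ((pairsSuccEquiv m).symm p)

theorem extendExponents_injective {m : ℕ} :
    Function.Injective (extendExponents : (Pairs m → ℕ) → _) := by
  intro k l h
  ext p
  have := congrFun h (pairsSuccEquiv m (Sum.inl p))
  simpa [extendExponents] using this

theorem raisingTerm_extendExponents {m : ℕ} {α : Fin (m + 1) → ℤ} (h : α (Fin.last m) = 0)
    (k : Pairs m → ℕ) :
    raisingTerm α (extendExponents k) = raisingTerm (fun i => α i.castSucc) k := by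
  have hsum (f : Fin (m + 1) × Fin (m + 1) → Fin (m + 1)) (i : Fin (m + 1)) :
      (∑ p : Pairs (m + 1), if f p.1 = i then (extendExponents k p : ℤ) else 0)
        = ∑ p : Pairs m, if f (pairsCastSucc p).1 = i then (k p : ℤ) else 0 := by
    rw [← (pairsSuccEquiv m).sum_comp, Fintype.sum_sum_type]
    simp only [extendExponents, Equiv.symm_apply_apply, Sum.elim_inl, Sum.elim_inr,
      Nat.cast_zero, ite_self, Finset.sum_const_zero, add_zero]
    rfl
  have hprod : ∏ p, raisingCoeff (extendExponents k p) = ∏ p, raisingCoeff (k p) := by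
    rw [← (pairsSuccEquiv m).prod_comp, Fintype.prod_sum_type]
    simp [extendExponents, raisingCoeff]
  have hlast : raise (extendExponents k) α (Fin.last m) = 0 := by
    rw [raise, sum_ite_fst_last, h, hsum Prod.snd]
    simp [pairsCastSucc, (Fin.castSucc_lt_last _).ne]
  have hcast (i : Fin m) :
      raise (extendExponents k) α i.castSucc = raise k (fun i => α i.castSucc) i := by
    rw [raise, hsum Prod.fst, hsum Prod.snd, raise]
    simp [pairsCastSucc]
  have h0 : qInt 0 = 1 := by simp [qInt, q_zero]
  rw [raisingTerm, raisingTerm, hprod, Fin.prod_univ_castSucc, hlast, h0, mul_one]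
  simp only [hcast]

/-- An operator involving the last position would make its index negative; the surviving terms have
the factor `q_0 = 1` there. -/
theorem hallQ_castSucc {m : ℕ} {α : Fin (m + 1) → ℤ} (h : α (Fin.last m) = 0) :
    hallQ α = hallQ fun i : Fin m => α i.castSucc := by
  rw [hallQ, hallQ, ← finsum_comp_of_injective extendExponents_injective]
  · exact finsum_congr (raisingTerm_extendExponents h)
  · intro k hk
    have h1 : 0 ≤ raise k α (Fin.last m) := by
      by_contra hc
      refine hk ?_
      rw [raisingTerm, Finset.prod_eq_zero (Finset.mem_univ (Fin.last m)), smul_zero]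
      exact qInt_of_neg (not_le.mp hc)
    rw [raise, sum_ite_fst_last, h] at h1
    have h2 : (∑ p : Pairs (m + 1), if p.1.2 = Fin.last m then (k p : ℤ) else 0) = 0 :=
      le_antisymm (by linarith) (Finset.sum_nonneg fun p _ => by split_ifs <;> simp)
    rw [Finset.sum_eq_zero_iff_of_nonneg fun p _ => by split_ifs <;> simp] at h2
    refine ⟨fun p => k (pairsCastSucc p), ?_⟩
    ext p
    obtain ⟨x, rfl⟩ := (pairsSuccEquiv m).surjective p
    rcases x with x | x
    · rw [extendExponents, Equiv.symm_apply_apply, pairsSuccEquiv_inl, Sum.elim_inl]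
    · have := h2 (pairsSuccEquiv m (Sum.inr x)) (Finset.mem_univ _)
      rw [if_pos (show (pairsSuccEquiv m (Sum.inr x)).1.2 = Fin.last m from rfl)] at this
      simp only [extendExponents, Equiv.symm_apply_apply, Sum.elim_inr]
      exact_mod_cast this.symm

theorem hallQ_eq_hallLittlewoodQ {m : ℕ} {α : Fin m → ℤ} {L : List ℕ} (hL : L.length ≤ m)
    (h : ∀ i : Fin m, α i = (L.getD i 0 : ℕ)) : hallQ α = hallLittlewoodQ L := by
  induction m, hL using Nat.le_induction with
  | base =>
    rw [hallLittlewoodQ]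
    congr 1
    ext i
    rw [h, List.getD_eq_getElem _ _ i.2]
    rfl
  | succ m hm ih =>
    rw [hallQ_castSucc, ih fun i => h i.castSucc]
    rw [h, List.getD_eq_default _ _ (by simpa using hm)]
    rfl

/-! ### Partitions and weakly decreasing sequences -/

theorem exists_list_of_antitone {m : ℕ} {α : Fin m → ℤ} (h : Antitone α) (h0 : ∀ i, 0 ≤ α i) :
    ∃ L : List ℕ, L.Pairwise (· ≥ ·) ∧ (∀ x ∈ L, 0 < x) ∧ L.length ≤ m ∧
      (L.sum : ℤ) = ∑ i, α i ∧ ∀ i : Fin m, α i = (L.getD i 0 : ℕ) := by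
  induction m with
  | zero => exact ⟨[], by simp⟩
  | succ m ih =>
    by_cases hz : α 0 = 0
    · have hall (i : Fin (m + 1)) : α i = 0 := le_antisymm (hz ▸ h (Fin.zero_le i)) (h0 i)
      exact ⟨[], by simp [hall]⟩
    · obtain ⟨L, h1, h2, h3, h4, h5⟩ := ih (α := fun i => α i.succ)
        (fun i j hij => h (Fin.succ_le_succ_iff.mpr hij)) fun i => h0 _
      have hpos := h0 0
      refine ⟨(α 0).toNat :: L, List.pairwise_cons.mpr ⟨fun x hx => ?_, h1⟩, ?_, ?_, ?_, ?_⟩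
      · obtain ⟨i, hi, rfl⟩ := List.getElem_of_mem hx
        have := h5 ⟨i, by omega⟩
        rw [List.getD_eq_getElem _ _ hi] at this
        have h6 := h (Fin.zero_le (Fin.succ ⟨i, by omega⟩))
        omega
      · intro x hx
        rcases List.mem_cons.mp hx with rfl | hx
        · omega
        · exact h2 x hx
      · simpa using h3
      · rw [Fin.sum_univ_succ, ← h4, List.sum_cons]
        push_cast
        omega
      · intro i
        refine Fin.cases ?_ (fun i => ?_) i
        · simp; omega
        · simpa using h5 i

theorem list_eq_of_getD_eq {L₁ L₂ : List ℕ} (h₁ : ∀ x ∈ L₁, 0 < x) (h₂ : ∀ x ∈ L₂, 0 < x)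
    (h : ∀ i, L₁.getD i 0 = L₂.getD i 0) : L₁ = L₂ := by
  have aux {L₁ L₂ : List ℕ} (h₂ : ∀ x ∈ L₂, 0 < x) (h : ∀ i, L₁.getD i 0 = L₂.getD i 0) :
      L₂.length ≤ L₁.length := by
    by_contra! hlt
    have := h L₁.length
    rw [List.getD_eq_default _ _ le_rfl, List.getD_eq_getElem _ _ hlt] at this
    have := h₂ _ (List.getElem_mem hlt)
    omega
  refine List.ext_getElem (le_antisymm (aux h₁ fun i => (h i).symm) (aux h₂ h)) fun i h3 h4 => ?_
  have := h i
  rwa [List.getD_eq_getElem _ _ h3, List.getD_eq_getElem _ _ h4] at this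

theorem pairwise_rows {n : ℕ} (lam : Nat.Partition n) : (rows lam).Pairwise (· ≥ ·) :=
  Multiset.pairwise_sort _ _

theorem coe_rows {n : ℕ} (lam : Nat.Partition n) : (rows lam : Multiset ℕ) = lam.parts :=
  Multiset.sort_eq _ _

theorem pos_of_mem_rows {n : ℕ} {lam : Nat.Partition n} {x : ℕ} (h : x ∈ rows lam) : 0 < x :=
  lam.parts_pos ((Multiset.mem_sort _).mp h)

theorem sum_rows {n : ℕ} (lam : Nat.Partition n) : (rows lam).sum = n := by
  rw [← Multiset.sum_coe, coe_rows, lam.parts_sum]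

theorem rows_injective {n : ℕ} : Function.Injective (rows : Nat.Partition n → List ℕ) := by
  intro a b h
  ext1
  rw [← coe_rows, ← coe_rows, h]

theorem exists_rows_eq {n : ℕ} {L : List ℕ} (h : L.Pairwise (· ≥ ·)) (hpos : ∀ x ∈ L, 0 < x)
    (hsum : L.sum = n) : ∃ lam : Nat.Partition n, rows lam = L := by
  refine ⟨⟨L, fun hi => hpos _ hi, by simpa using hsum⟩, ?_⟩
  refine List.Perm.eq_of_pairwise' (r := (· ≥ ·)) (pairwise_rows _) h ?_
  rw [← Multiset.coe_eq_coe, coe_rows]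

/-! ### Expansion by straightening coefficients -/

theorem straightCoeff_of_antitone {m : ℕ} (σ : StraighteningOrder m) (L : List ℕ)
    {α : Fin m → ℤ} (h : Antitone α)
    [Decidable (L.length ≤ m ∧ ∀ i : Fin m, α i = (L.getD i 0 : ℕ))] :
    straightCoeff σ L α
      = if L.length ≤ m ∧ ∀ i : Fin m, α i = (L.getD i 0 : ℕ) then 1 else 0 := by
  rw [straightCoeff, dif_pos h]
  congr

theorem hallQ_eq_sum_of_antitone {K : ℕ} {nu : List ℕ} (σ : StraighteningOrder nu.length)
    {α : Fin nu.length → ℤ} (hle : ∀ i, α i ≤ nu.get i) (hsum : ∑ i, α i = K)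
    (h : Antitone α) :
    hallQ α = ∑ lam ∈ subPartitions K nu,
      straightCoeff σ (rows lam) α • hallLittlewoodQ (rows lam) := by
  classical
  simp only [straightCoeff_of_antitone σ _ h]
  by_cases h0 : ∀ i, 0 ≤ α i
  · obtain ⟨L, h1, h2, h3, h4, h5⟩ := exists_list_of_antitone h h0
    obtain ⟨lam, rfl⟩ := exists_rows_eq h1 h2 (n := K) (by rw [hsum] at h4; exact_mod_cast h4)
    rw [Finset.sum_eq_single lam, if_pos ⟨h3, h5⟩, one_smul, hallQ_eq_hallLittlewoodQ h3 h5]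
    · intro lam' _ hne
      rw [if_neg, zero_smul]
      rintro ⟨h6, h7⟩
      refine hne (rows_injective (list_eq_of_getD_eq (fun _ => pos_of_mem_rows)
        (fun _ => pos_of_mem_rows) fun i => ?_))
      by_cases hi : i < nu.length
      · exact_mod_cast (h7 ⟨i, hi⟩).symm.trans (h5 ⟨i, hi⟩)
      · rw [List.getD_eq_default _ _ (by omega), List.getD_eq_default _ _ (by omega)]
    · intro hnot
      refine absurd ?_ hnot
      rw [subPartitions, Finset.mem_filter]
      refine ⟨Finset.mem_univ _, fun i => ?_⟩
      by_cases hi : i < nu.length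
      · have := (h5 ⟨i, hi⟩).symm.trans_le (hle ⟨i, hi⟩)
        rw [List.getD_eq_getElem nu _ hi]
        exact_mod_cast this
      · rw [List.getD_eq_default _ _ (by omega)]
        exact Nat.zero_le _
  · push Not at h0
    obtain ⟨i, hi⟩ := h0
    rw [hallQ_eq_zero_of_antitone h hi]
    refine (Finset.sum_eq_zero fun lam _ => ?_).symm
    rw [if_neg, zero_smul]
    rintro ⟨-, h1⟩
    rw [h1 i] at hi
    omega

theorem hallQ_eq_sum_straightStep {m : ℕ} {i j : Fin m} (hij : (i : ℕ) + 1 = j) {α : Fin m → ℤ}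
    (h : α i < α j) :
    hallQ α = ∑ a : Fin ((α j - α i).toNat / 2 + 1),
      stepCoeff (α j - α i).toNat a • hallQ (straightStep i j a α) := by
  have h1 := eq_sum_stepCoeff_of_exchange (fun a b => hallQ_exchange hij α a b)
    (α j - α i).toNat (by omega) (α i) (α j) (by omega)
  have h2 : setPair i j α (α i) (α j) = α := by
    ext k
    unfold setPair
    split_ifs with h3 h4
    · rw [h3]
    · rw [h4]
    · rfl
  rw [h2, Finset.sum_range] at h1
  exact h1

/-- Induction on `disorder`, following the recursion of `straightCoeff`. The sum of the entries and
the bound by `ν` are invariants of a step. -/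
theorem hallQ_eq_sum_straightCoeff {K : ℕ} {nu : List ℕ} (hnu : nu.Pairwise (· ≥ ·))
    (σ : StraighteningOrder nu.length) {α : Fin nu.length → ℤ} (hle : ∀ i, α i ≤ nu.get i)
    (hsum : ∑ i, α i = K) :
    hallQ α = ∑ lam ∈ subPartitions K nu,
      straightCoeff σ (rows lam) α • hallLittlewoodQ (rows lam) := by
  induction hd : disorder α using Nat.strong_induction_on generalizing α with
  | _ d ih =>
    by_cases h : Antitone α
    · exact hallQ_eq_sum_of_antitone σ hle hsum h
    · have hs (lam : Nat.Partition K) : straightCoeff σ (rows lam) α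
          = ∑ a : Fin ((α (σ α h).1.2 - α (σ α h).1.1).toNat / 2 + 1),
            stepCoeff (α (σ α h).1.2 - α (σ α h).1.1).toNat a *
              straightCoeff σ (rows lam) (straightStep (σ α h).1.1 (σ α h).1.2 a α) := by
        rw [straightCoeff, dif_neg h]
      simp only [hs]
      obtain ⟨⟨i, j⟩, hij, hlt⟩ := σ α h
      simp only at hij hlt ⊢
      have hne : i ≠ j := by rintro rfl; omega
      have hget : nu.get j ≤ nu.get i :=
        List.pairwise_iff_get.mp hnu i j (by rw [Fin.lt_def]; omega)
      have hstep (a : Fin ((α j - α i).toNat / 2 + 1)) : hallQ (straightStep i j a α)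
          = ∑ lam ∈ subPartitions K nu,
            straightCoeff σ (rows lam) (straightStep i j a α) • hallLittlewoodQ (rows lam) := by
        have ha := a.2
        refine ih _ ?_ (fun k => ?_) ?_ rfl
        · rw [← hd]
          exact disorder_step_lt α i j hij hlt a (by omega)
        -- The larger entry moves left, where the bound is weaker because `ν` decreases; position
        -- `j` receives `α i + a ≤ α j`.
        · have hi := hle i
          have hj := hle j
          unfold straightStep
          split_ifs with h1 h2
          · subst h1; omega
          · subst h2; omega
          · exact hle k
        · rw [← hsum, ← Finset.add_sum_erase _ _ (Finset.mem_univ i),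
            ← Finset.add_sum_erase _ α (Finset.mem_univ i),
            ← Finset.add_sum_erase _ _ (Finset.mem_erase.mpr ⟨hne.symm, Finset.mem_univ j⟩),
            ← Finset.add_sum_erase _ α (Finset.mem_erase.mpr ⟨hne.symm, Finset.mem_univ j⟩),
            Finset.sum_congr rfl (g := α)]
          · simp only [straightStep, if_pos, if_neg hne.symm]
            ring
          · intro k hk
            rw [Finset.mem_erase, Finset.mem_erase] at hk
            simp [straightStep, hk.1, hk.2.1]
      rw [hallQ_eq_sum_straightStep hij hlt]
      simp only [hstep, Finset.smul_sum, Finset.sum_smul, mul_smul]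
      exact Finset.sum_comm

/-- For the empty partition the default head `0` is harmless, since `q 0 = 1`. -/
theorem qProd_rows {n : ℕ} (mu : Nat.Partition n) :
    qProd (rows mu) = q ((rows mu).headD 0) * qProd (rows mu).tail := by
  cases rows mu <;> simp [qProd, q_zero]

theorem headD_rows_le {n : ℕ} (mu : Nat.Partition n) : (rows mu).headD 0 ≤ n := by
  have := sum_rows mu
  cases h : rows mu with
  | nil => simp
  | cons a L =>
    rw [h, List.sum_cons] at this
    simp only [List.headD_cons]
    omega

end

end HallLittlewood

theorem theoremt (n : ℕ) (μ ν : Nat.Partition n)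
    (σ : HallLittlewood.StraighteningOrder (HallLittlewood.rows ν).length) :
    HallLittlewood.pairingB (HallLittlewood.rows ν) (HallLittlewood.rows μ) =
      ∑ lam ∈ HallLittlewood.subPartitions (n - (HallLittlewood.rows μ).headD 0)
          (HallLittlewood.rows ν),
        ∑ τ ∈ Finset.piAntidiag (Finset.univ : Finset (Fin (HallLittlewood.rows ν).length))
            ((HallLittlewood.rows μ).headD 0),
          (1 - HallLittlewood.t) ^ (Finset.univ.filter fun i => τ i ≠ 0).card *
            HallLittlewood.straightCoeff σ (HallLittlewood.rows lam)
              (fun i => ((HallLittlewood.rows ν).get i : ℤ) - (τ i : ℤ)) *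
            HallLittlewood.pairingB (HallLittlewood.rows lam) (HallLittlewood.rows μ).tail := by
  rw [HallLittlewood.pairingB, HallLittlewood.qProd_rows, ← HallLittlewood.form_skew,
    HallLittlewood.hallLittlewoodQ, HallLittlewood.skew_hallQ, map_sum,
    LinearMap.sum_apply, Finset.sum_comm]
  refine Finset.sum_congr rfl fun τ hτ => ?_
  have hsum : ∑ i, (((HallLittlewood.rows ν).get i : ℤ) - (τ i : ℤ))
      = ((n - (HallLittlewood.rows μ).headD 0 : ℕ) : ℤ) := by
    have hν : ∑ i, (HallLittlewood.rows ν).get i = n := by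
      rw [← List.sum_ofFn, List.ofFn_get, HallLittlewood.sum_rows]
    rw [Finset.sum_sub_distrib, Nat.cast_sub (HallLittlewood.headD_rows_le μ),
      ← (Finset.mem_piAntidiag.mp hτ).1, ← Nat.cast_sum, ← Nat.cast_sum, hν]
  rw [map_smul, LinearMap.smul_apply,
    HallLittlewood.hallQ_eq_sum_straightCoeff (HallLittlewood.pairwise_rows ν) σ
      (fun i => by simp) hsum, map_sum, LinearMap.sum_apply, Finset.smul_sum]
  refine Finset.sum_congr rfl fun lam _ => ?_
  rw [map_smul, LinearMap.smul_apply, smul_eq_mul, smul_eq_mul, HallLittlewood.pairingB, mul_assoc]
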